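/- **Setting.** Let $H$ be a Hopf algebra over a field with coproduct $\Delta$, and let $\Delta^{\mathrm{op}}=\tau\circ\Delta$, where $\tau(a\otimes b)=b\otimes a$. For $R=\sum a\otimes b\in H\otimes H$ write $R_{12}=\sum a\otimes b\otimes 1$, $R_{13}=\sum a\otimes 1\otimes b$, $R_{23}=\sum 1\otimes a\otimes b$. An *$R$-matrix* for $H$ is an invertible element $R\in H\otimes H$ such that $$R\,\Delta(h)=\Delta^{\mathrm{op}}(h)\,R\quad(h\in H),\qquad (\Delta\otimes\mathrm{id})(R)=R_{13}R_{23},\qquad (\mathrm{id}\otimes\Delta)(R)=R_{13}R_{12}.$$ The (Zariski) tangent space $\mathbf T_R\mathrm{RMat}(H)$ at an $R$-matrix $R$ is the space of all $T\in H\otimes H$ such that $$T\,\Delta(h)=\Delta^{\mathrm{op}}(h)\,T\quad(h\in H),\qquad (\Delta\otimes\mathrm{id})(T)=T_{13}R_{23}+R_{13}T_{23},\qquad (\mathrm{id}\otimes\Delta)(T)=T_{13}R_{12}+R_{13}T_{12}.$$ For an integer $k\ge 1$ let $B_k=\Lambda\mathbb C^k\rtimes\mathbb C[\mathbb Z/2\mathbb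 Z]$ be the $\mathbb C$-algebra generated by $x_1,\dots,x_k,g$ with relations $x_ix_j=-x_jx_i$, $gx_i=-x_ig$, $x_i^2=0$, $g^2=1$; it is a Hopf algebra with $\Delta(x_i)=1\otimes x_i+x_i\otimes g$, $\Delta(g)=g\otimes g$, $\varepsilon(x_i)=0$, $\varepsilon(g)=1$, $S(x_i)=gx_i$, $S(g)=g$. Let $$R_0=\tfrac{1+g}{2}\otimes 1+\tfrac{1-g}{2}\otimes g\in B_k\otimes B_k.$$ **Proposition.** 1. The elements $R_0\,(x_i\otimes x_jg)$, for $1\le i,j\le k$, form a basis of $\mathbf T_{R_0}\mathrm{RMat}(B_k)$. 2. For every $\lambda=(\lambda_{i,j})_{1\le i,j\le k}\in\mathbb C^{k^2}$, the element $\sum_{i,j=1}^k\lambda_{i,j}\,x_i\otimes x_jg$ is nilpotent, and $$R_\lambda:=R_0\prod_{i,j=1}^k\bigl(1\otimes 1+\lambda_{i,j}\,x_i\otimes x_jg\bigr)=R_0\exp\Bigl(\sum_{i,j=1}^k\lambda_{i,j}\,x_i\otimes x_jg\Bigr)$$ is an $R$-matrix for $B_k$ (the factors of the product commute). Moreover $R_{\lambda+\mu}=R_\lambda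 R_0R_\mu$ for all $\lambda,\mu\in\mathbb C^{k^2}$. -/

import Mathlib

open scoped TensorProduct

noncomputable section

section RMatrices

variable {K : Type*} [Field K] {H : Type*} [Ring H] [HopfAlgebra K H]

/-- The embedding `a ⊗ b ↦ a ⊗ b ⊗ 1`, so that `leg12 R` is `R₁₂`. -/
def leg12 : H ⊗[K] H →ₐ[K] (H ⊗[K] H) ⊗[K] H :=
  Algebra.TensorProduct.includeLeft

/-- The embedding `a ⊗ b ↦ a ⊗ 1 ⊗ b`, so that `leg13 R` is `R₁₃`. -/
def leg13 : H ⊗[K] H →ₐ[K] (H ⊗[K] H) ⊗[K] H :=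
  Algebra.TensorProduct.map Algebra.TensorProduct.includeLeft (AlgHom.id K H)

/-- The embedding `a ⊗ b ↦ 1 ⊗ a ⊗ b`, so that `leg23 R` is `R₂₃`. -/
def leg23 : H ⊗[K] H →ₐ[K] (H ⊗[K] H) ⊗[K] H :=
  Algebra.TensorProduct.map Algebra.TensorProduct.includeRight (AlgHom.id K H)

/-- The map `Δ ⊗ id : H ⊗ H → H ⊗ H ⊗ H`. -/
def comulLeft : H ⊗[K] H →ₐ[K] (H ⊗[K] H) ⊗[K] H :=
  Algebra.TensorProduct.map (Bialgebra.comulAlgHom K H) (AlgHom.id K H)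

/-- The map `id ⊗ Δ : H ⊗ H → H ⊗ H ⊗ H` (target bracketed to the left). -/
def comulRight : H ⊗[K] H →ₐ[K] (H ⊗[K] H) ⊗[K] H :=
  (Algebra.TensorProduct.assoc K K K H H H).symm.toAlgHom.comp
    (Algebra.TensorProduct.map (AlgHom.id K H) (Bialgebra.comulAlgHom K H))

/-- The opposite coproduct `Δᵒᵖ = τ ∘ Δ`. -/
def comulOp : H →ₐ[K] H ⊗[K] H :=
  (Algebra.TensorProduct.comm K H H).toAlgHom.comp (Bialgebra.comulAlgHom K H)

/-- `R ∈ H ⊗ H` is an `R`-matrix for the Hopf algebra `H`. -/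
structure IsRMatrix (R : H ⊗[K] H) : Prop where
  isUnit : IsUnit R
  mul_comul : ∀ h : H, R * Bialgebra.comulAlgHom K H h = comulOp h * R
  comulLeft_eq : comulLeft R = leg13 R * leg23 R
  comulRight_eq : comulRight R = leg13 R * leg12 R

/-- The Zariski tangent space at `R` of the variety of `R`-matrices of `H`, i.e. the space of
solutions of the `R`-matrix equations linearised at `R`. -/
def tangentRMat (R : H ⊗[K] H) : Submodule K (H ⊗[K] H) where
  carrier := {T | (∀ h : H, T * Bialgebra.comulAlgHom K H h = comulOp h * T) ∧
    comulLeft T = leg13 T * leg23 R + leg13 R * leg23 T ∧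
    comulRight T = leg13 T * leg12 R + leg13 R * leg12 T}
  zero_mem' := by simp
  add_mem' := by
    rintro S T ⟨hS1, hS2, hS3⟩ ⟨hT1, hT2, hT3⟩
    refine ⟨fun h => ?_, ?_, ?_⟩
    · rw [add_mul, mul_add, hS1, hT1]
    · simp only [map_add, hS2, hT2, add_mul, mul_add]; abel
    · simp only [map_add, hS3, hT3, add_mul, mul_add]; abel
  smul_mem' := by
    rintro c T ⟨hT1, hT2, hT3⟩
    refine ⟨fun h => ?_, ?_, ?_⟩
    · rw [smul_mul_assoc, mul_smul_comm, hT1]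
    · simp only [map_smul, hT2, smul_add, smul_mul_assoc, mul_smul_comm]
    · simp only [map_smul, hT3, smul_add, smul_mul_assoc, mul_smul_comm]

end RMatrices

/-! The Hopf algebra `B_k`, by generators and relations. -/

/-- Generators of `B_k`. -/
inductive BkGen (k : ℕ) : Type
  | x (i : Fin k) : BkGen k
  | g : BkGen k

/-- Defining relations of `B_k`. -/
inductive BkRel (k : ℕ) : FreeAlgebra ℂ (BkGen k) → FreeAlgebra ℂ (BkGen k) → Prop
  | x_mul_x (i j : Fin k) :
      BkRel k (FreeAlgebra.ι ℂ (.x i) * FreeAlgebra.ι ℂ (.x j))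
        (-(FreeAlgebra.ι ℂ (.x j) * FreeAlgebra.ι ℂ (.x i)))
  | g_mul_x (i : Fin k) :
      BkRel k (FreeAlgebra.ι ℂ .g * FreeAlgebra.ι ℂ (.x i))
        (-(FreeAlgebra.ι ℂ (.x i) * FreeAlgebra.ι ℂ .g))
  | x_sq (i : Fin k) : BkRel k (FreeAlgebra.ι ℂ (.x i) ^ 2) 0
  | g_sq : BkRel k (FreeAlgebra.ι ℂ .g ^ 2) 1

/-- The algebra `B_k = Λℂᵏ ⋊ ℂ[ℤ/2ℤ]`. -/
def Bk (k : ℕ) : Type := RingQuot (BkRel k)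

namespace Bk

variable {k : ℕ}

instance instRing : Ring (Bk k) := inferInstanceAs (Ring (RingQuot (BkRel k)))

instance instAlgebra : Algebra ℂ (Bk k) := inferInstanceAs (Algebra ℂ (RingQuot (BkRel k)))

variable (k) in
/-- The quotient map from the free algebra. -/
def mk : FreeAlgebra ℂ (BkGen k) →ₐ[ℂ] Bk k := RingQuot.mkAlgHom ℂ (BkRel k)

theorem mk_rel {a b : FreeAlgebra ℂ (BkGen k)} (h : BkRel k a b) : mk k a = mk k b :=
  RingQuot.mkAlgHom_rel ℂ h

/-- The generator `x_i` of `B_k`. -/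
def x (i : Fin k) : Bk k := mk k (FreeAlgebra.ι ℂ (.x i))

variable (k) in
/-- The generator `g` of `B_k`. -/
def g : Bk k := mk k (FreeAlgebra.ι ℂ .g)

theorem x_mul_x (i j : Fin k) : x i * x j = -(x j * x i) := by
  have := mk_rel (BkRel.x_mul_x i j)
  simpa [x] using this

theorem g_mul_x (i : Fin k) : g k * x i = -(x i * g k) := by
  have := mk_rel (BkRel.g_mul_x i)
  simpa [x, g] using this

theorem x_mul_self (i : Fin k) : x i * x i = 0 := by
  have := mk_rel (BkRel.x_sq i)
  simpa [x, sq] using this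

theorem g_mul_self : g k * g k = 1 := by
  have := mk_rel (BkRel.g_sq (k := k))
  simpa [g, sq] using this

/-- The algebra morphism `B_k → A` with prescribed values on the generators. -/
def lift {A : Type*} [Ring A] [Algebra ℂ A] (X : Fin k → A) (G : A)
    (h1 : ∀ i j, X i * X j = -(X j * X i)) (h2 : ∀ i, G * X i = -(X i * G))
    (h3 : ∀ i, X i * X i = 0) (h4 : G * G = 1) : Bk k →ₐ[ℂ] A :=
  (RingQuot.liftAlgHom ℂ ⟨FreeAlgebra.lift ℂ fun s => match s with
    | .x i => X i
    | .g => G, by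
    intro a b h
    cases h with
    | x_mul_x i j => simpa using h1 i j
    | g_mul_x i => simpa using h2 i
    | x_sq i => simpa [sq] using h3 i
    | g_sq => simpa [sq] using h4⟩ : RingQuot (BkRel k) →ₐ[ℂ] A)

section lift
variable {A : Type*} [Ring A] [Algebra ℂ A] (X : Fin k → A) (G : A)
    (h1 : ∀ i j, X i * X j = -(X j * X i)) (h2 : ∀ i, G * X i = -(X i * G))
    (h3 : ∀ i, X i * X i = 0) (h4 : G * G = 1)

@[simp] theorem lift_x (i : Fin k) : lift X G h1 h2 h3 h4 (x i) = X i := by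
  refine (RingQuot.liftAlgHom_mkAlgHom_apply ℂ _ _ _).trans ?_
  simp

@[simp] theorem lift_g : lift X G h1 h2 h3 h4 (g k) = G := by
  refine (RingQuot.liftAlgHom_mkAlgHom_apply ℂ _ _ _).trans ?_
  simp
end lift

theorem algHom_ext {A : Type*} [Ring A] [Algebra ℂ A] {φ ψ : Bk k →ₐ[ℂ] A}
    (hx : ∀ i, φ (x i) = ψ (x i)) (hg : φ (g k) = ψ (g k)) : φ = ψ := by
  apply RingQuot.ringQuot_ext' ℂ
  apply FreeAlgebra.hom_ext
  funext s
  cases s with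
  | x i => exact hx i
  | g => exact hg

theorem induction {P : Bk k → Prop} (hc : ∀ c : ℂ, P (algebraMap ℂ (Bk k) c))
    (hx : ∀ i, P (x i)) (hg : P (g k)) (hadd : ∀ a b, P a → P b → P (a + b))
    (hmul : ∀ a b, P a → P b → P (a * b)) (a : Bk k) : P a := by
  obtain ⟨a, rfl⟩ : ∃ b, mk k b = a := RingQuot.mkAlgHom_surjective ℂ (BkRel k) a
  induction a using FreeAlgebra.induction with
  | grade0 c => simpa using hc c
  | grade1 s => cases s with
    | x i => exact hx i
    | g => exact hg
  | mul a b ha hb => simpa using hmul _ _ ha hb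
  | add a b ha hb => simpa using hadd _ _ ha hb

variable (k) in
/-- `Δ(x_i) = 1 ⊗ x_i + x_i ⊗ g`, `Δ(g) = g ⊗ g`. -/
def comulHom : Bk k →ₐ[ℂ] Bk k ⊗[ℂ] Bk k :=
  lift (fun i => 1 ⊗ₜ x i + x i ⊗ₜ g k) (g k ⊗ₜ g k)
    (by
      intro i j
      simp only [add_mul, mul_add, Algebra.TensorProduct.tmul_mul_tmul, one_mul, mul_one,
        g_mul_x, g_mul_self, x_mul_x i j, TensorProduct.neg_tmul, TensorProduct.tmul_neg]
      abel)
    (by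
      intro i
      simp only [add_mul, mul_add, Algebra.TensorProduct.tmul_mul_tmul, one_mul, mul_one,
        g_mul_x, g_mul_self, TensorProduct.neg_tmul, TensorProduct.tmul_neg]
      abel)
    (by
      intro i
      simp only [add_mul, mul_add, Algebra.TensorProduct.tmul_mul_tmul, one_mul, mul_one,
        g_mul_x, g_mul_self, x_mul_self, TensorProduct.tmul_neg,
        TensorProduct.zero_tmul, TensorProduct.tmul_zero]
      abel)
    (by simp [g_mul_self, Algebra.TensorProduct.one_def])

variable (k) in
/-- `ε(x_i) = 0`, `ε(g) = 1`. -/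
def counitHom : Bk k →ₐ[ℂ] ℂ :=
  lift (fun _ => 0) 1 (by simp) (by simp) (by simp) (by simp)

variable (k) in
/-- The antipode `S(x_i) = g x_i`, `S(g) = g`, as an algebra morphism to the opposite algebra. -/
def antipodeHom : Bk k →ₐ[ℂ] (Bk k)ᵐᵒᵖ :=
  lift (fun i => MulOpposite.op (g k * x i)) (MulOpposite.op (g k))
    (by
      have key : ∀ i j : Fin k, g k * x i * (g k * x j) = -(x i * x j) := fun i j => by
        rw [g_mul_x i, neg_mul, mul_assoc, ← mul_assoc (g k) (g k), g_mul_self, one_mul]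
      intro i j
      rw [← MulOpposite.op_mul, ← MulOpposite.op_mul, ← MulOpposite.op_neg, key, key, x_mul_x])
    (by
      intro i
      rw [← MulOpposite.op_mul, ← MulOpposite.op_mul, ← MulOpposite.op_neg, mul_assoc,
        ← mul_neg, g_mul_x, neg_neg])
    (by
      intro i
      rw [← MulOpposite.op_mul, g_mul_x, neg_mul, mul_assoc, ← mul_neg]
      simp [← mul_assoc, g_mul_self, x_mul_self, ← g_mul_x])
    (by rw [← MulOpposite.op_mul, g_mul_self, MulOpposite.op_one])

instance instBialgebra : Bialgebra ℂ (Bk k) :=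
  Bialgebra.ofAlgHom (comulHom k) (counitHom k)
    (by
      apply algHom_ext
      · intro i
        simp [comulHom, TensorProduct.add_tmul, TensorProduct.tmul_add,
          Algebra.TensorProduct.one_def, add_assoc]
      · simp [comulHom])
    (by
      apply algHom_ext
      · intro i
        simp [comulHom, counitHom]
      · simp [comulHom, counitHom])
    (by
      apply algHom_ext
      · intro i
        simp [comulHom, counitHom]
      · simp [comulHom, counitHom])

theorem comul_eq (a : Bk k) : Coalgebra.comul (R := ℂ) a = comulHom k a := rfl

theorem counit_eq (a : Bk k) : Coalgebra.counit (R := ℂ) a = counitHom k a := rfl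

variable (k) in
/-- The antipode as a linear map. -/
def antipodeLin : Bk k →ₗ[ℂ] Bk k :=
  (MulOpposite.opLinearEquiv ℂ).symm.toLinearMap ∘ₗ (antipodeHom k).toLinearMap

theorem antipodeLin_mul (a b : Bk k) :
    antipodeLin k (a * b) = antipodeLin k b * antipodeLin k a := by
  simp [antipodeLin]

theorem antipodeLin_algebraMap (c : ℂ) :
    antipodeLin k (algebraMap ℂ (Bk k) c) = algebraMap ℂ (Bk k) c := by
  simp [antipodeLin]

theorem antipodeLin_x (i : Fin k) : antipodeLin k (x i) = g k * x i := by
  simp [antipodeLin, antipodeHom]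

theorem antipodeLin_g : antipodeLin k (g k) = g k := by
  simp [antipodeLin, antipodeHom]

theorem antipode_left_aux (u v : Bk k) (s : Bk k ⊗[ℂ] Bk k) :
    LinearMap.mul' ℂ (Bk k) ((antipodeLin k).rTensor (Bk k) (s * (u ⊗ₜ v))) =
      antipodeLin k u * LinearMap.mul' ℂ (Bk k) ((antipodeLin k).rTensor (Bk k) s) * v := by
  induction s with
  | zero => simp
  | tmul a b => simp [antipodeLin_mul, mul_assoc]
  | add a b ha hb => simp only [add_mul, map_add, ha, hb, mul_add]

theorem antipode_right_aux (u v : Bk k) (s : Bk k ⊗[ℂ] Bk k) :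
    LinearMap.mul' ℂ (Bk k) ((antipodeLin k).lTensor (Bk k) ((u ⊗ₜ v) * s)) =
      u * LinearMap.mul' ℂ (Bk k) ((antipodeLin k).lTensor (Bk k) s) * antipodeLin k v := by
  induction s with
  | zero => simp
  | tmul a b => simp [antipodeLin_mul, mul_assoc]
  | add a b ha hb => simp only [add_mul, map_add, ha, hb, mul_add]

theorem antipode_left (a : Bk k) :
    LinearMap.mul' ℂ (Bk k) ((antipodeLin k).rTensor (Bk k) (comulHom k a)) =
      algebraMap ℂ (Bk k) (counitHom k a) := by
  induction a using Bk.induction with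
  | hc c => simp [Algebra.TensorProduct.algebraMap_apply, antipodeLin_algebraMap]
  | hx i =>
    have h1 : antipodeLin k 1 = 1 := by simpa using antipodeLin_algebraMap (k := k) 1
    simp [comulHom, counitHom, antipodeLin_x, h1, g_mul_x, mul_assoc, g_mul_self]
  | hg => simp [comulHom, counitHom, antipodeLin_g, g_mul_self]
  | hadd a b ha hb => simp only [map_add, ha, hb]
  | hmul a b ha hb =>
    have key : ∀ t : Bk k ⊗[ℂ] Bk k,
        LinearMap.mul' ℂ (Bk k) ((antipodeLin k).rTensor (Bk k) (comulHom k a * t)) =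
          algebraMap ℂ (Bk k) (counitHom k a) *
            LinearMap.mul' ℂ (Bk k) ((antipodeLin k).rTensor (Bk k) t) := by
      intro t
      induction t with
      | zero => simp
      | tmul u v =>
        rw [antipode_left_aux, ha, ← Algebra.commutes]
        simp [mul_assoc]
      | add s t hs ht => simp only [mul_add, map_add, hs, ht]
    rw [map_mul, key, hb, map_mul, map_mul]

theorem antipode_right (a : Bk k) :
    LinearMap.mul' ℂ (Bk k) ((antipodeLin k).lTensor (Bk k) (comulHom k a)) =
      algebraMap ℂ (Bk k) (counitHom k a) := by
  induction a using Bk.induction with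
  | hc c =>
    have h1 : antipodeLin k 1 = 1 := by simpa using antipodeLin_algebraMap (k := k) 1
    simp [Algebra.TensorProduct.algebraMap_apply, h1]
  | hx i => simp [comulHom, counitHom, antipodeLin_x, antipodeLin_g, g_mul_x]
  | hg => simp [comulHom, counitHom, antipodeLin_g, g_mul_self]
  | hadd a b ha hb => simp only [map_add, ha, hb]
  | hmul a b ha hb =>
    have key : ∀ t : Bk k ⊗[ℂ] Bk k,
        LinearMap.mul' ℂ (Bk k) ((antipodeLin k).lTensor (Bk k) (t * comulHom k b)) =
          algebraMap ℂ (Bk k) (counitHom k b) *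
            LinearMap.mul' ℂ (Bk k) ((antipodeLin k).lTensor (Bk k) t) := by
      intro t
      induction t with
      | zero => simp
      | tmul u v =>
        rw [antipode_right_aux, hb, ← Algebra.commutes]
        simp [mul_assoc]
      | add s t hs ht => simp only [add_mul, map_add, hs, ht, mul_add]
    rw [map_mul, key, ha, map_mul, map_mul, Algebra.commutes]

instance instHopfAlgebra : HopfAlgebra ℂ (Bk k) where
  antipode := antipodeLin k
  mul_antipode_rTensor_comul := LinearMap.ext antipode_left
  mul_antipode_lTensor_comul := LinearMap.ext antipode_right

variable (k) in
/-- The element `R₀ = e₊ ⊗ 1 + e₋ ⊗ g`, where `e₊ = (1 + g) / 2` and `e₋ = (1 - g) / 2`. -/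
def R0 : Bk k ⊗[ℂ] Bk k :=
  ((2⁻¹ : ℂ) • (1 + g k)) ⊗ₜ 1 + ((2⁻¹ : ℂ) • (1 - g k)) ⊗ₜ g k

/-- The element `x_i ⊗ x_j g`. -/
def X (i j : Fin k) : Bk k ⊗[ℂ] Bk k := x i ⊗ₜ (x j * g k)

theorem X_commute (i j l m : Fin k) : Commute (X i j) (X l m) := by
  have key : ∀ j m : Fin k, x j * g k * (x m * g k) = -(x j * x m) := fun j m => by
    rw [mul_assoc, ← mul_assoc (g k), g_mul_x, neg_mul, mul_assoc, g_mul_self, mul_one, mul_neg]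
  simp only [Commute, SemiconjBy, X, Algebra.TensorProduct.tmul_mul_tmul, key]
  rw [x_mul_x i l, x_mul_x j m, TensorProduct.neg_tmul, TensorProduct.tmul_neg]
  simp

/-- The element `R_λ = R₀ ∏ (1 ⊗ 1 + λ_{ij} x_i ⊗ x_j g)`. The product runs over all pairs
`(i, j)`; its factors commute, so that it is independent of their order. -/
def Rfam (lam : Fin k → Fin k → ℂ) : Bk k ⊗[ℂ] Bk k :=
  R0 k * (Finset.univ : Finset (Fin k × Fin k)).noncommProd
    (fun p => 1 + lam p.1 p.2 • X p.1 p.2) fun p _ q _ _ =>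
      ((Commute.one_left _).add_left (((Commute.one_right _).add_right
        ((X_commute p.1 p.2 q.1 q.2).smul_right _)).smul_left _))

/-- The rational vector space structure underlying the complex one; it is unique, and
`IsNilpotent.exp` asks for it. -/
instance instModuleRat : Module ℚ (Bk k ⊗[ℂ] Bk k) := Module.compHom _ (algebraMap ℚ ℂ)

end Bk

end

noncomputable section

namespace Bk

variable {k : ℕ}

/-! Since `R0` squares to `1`, every tensor is `R₀S` for a unique `S`, and
`R0_mul_mem_tangentRMat_iff` turns the tangent equations into: `S` commutes with every `Δ(h)`,
`(Δ⊗id)S = R₂₃S₁₃R₂₃ + S₂₃` and `(id⊗Δ)S = R₁₂S₁₃R₁₂ + S₁₂`, with `R = R₀`. For `S = x_i ⊗ x_j g`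
both conjugates equal `x_i ⊗ g ⊗ x_j g`, and the equations read off `Δ(x_i)` and `Δ(x_j g)`.

These solutions commute and are nilpotent, and the two summands on each right-hand side commute.
Exponentiating therefore turns the additive equations into the multiplicative ones for `R₀ exp S`
(`Rfam_isRMatrix`). Each `x_i ⊗ x_j g` squares to zero, so the exponential is the stated product.

That there are no other solutions is seen by contracting a leg of the equations with functionals.
Contraction with `coord i` yields a skew derivation `hit (coord i)`, and `∑ x_i g · hit (coord i)`
is the Euler derivation (`sum_hit_coord`), which is invertible modulo degree zero. The degree-zero
part is governed by the characters `ε` and `sgn`, whose contractions of `S` vanish. Hence `S` is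
recovered from its `coord` contractions: the right leg lies in the span of the `x_j g`
(`eq_sum_contrR_coord`), then the left leg in the span of the `x_i` (`eq_sum_contrL_coord`). -/

theorem g_mul_g_mul (a : Bk k) : g k * (g k * a) = a := by
  rw [← mul_assoc, g_mul_self, one_mul]

theorem g_mul_x_mul (i : Fin k) (a : Bk k) : g k * (x i * a) = -(x i * (g k * a)) := by
  rw [← mul_assoc, g_mul_x, neg_mul, mul_assoc]

/-! ### The base point `R₀` is an `R`-matrix. -/

theorem comulAlgHom_x (i : Fin k) :
    Bialgebra.comulAlgHom ℂ (Bk k) (x i) = 1 ⊗ₜ x i + x i ⊗ₜ g k := by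
  change comulHom k (x i) = _
  simp [comulHom]

theorem comulAlgHom_g : Bialgebra.comulAlgHom ℂ (Bk k) (g k) = g k ⊗ₜ g k := by
  change comulHom k (g k) = _
  simp [comulHom]

theorem comulOp_x (i : Fin k) :
    comulOp (K := ℂ) (x i) = x i ⊗ₜ[ℂ] (1 : Bk k) + g k ⊗ₜ x i := by
  simp [comulOp, comulAlgHom_x, -Bialgebra.comulAlgHom_apply]

theorem comulOp_g : comulOp (K := ℂ) (g k) = g k ⊗ₜ[ℂ] g k := by
  simp [comulOp, comulAlgHom_g, -Bialgebra.comulAlgHom_apply]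

/-- Two maps that are intertwined on generators are intertwined everywhere. -/
theorem intertwine {A : Type*} [Ring A] [Algebra ℂ A] (φ ψ : Bk k →ₐ[ℂ] A) (r : A)
    (hx : ∀ i, r * φ (x i) = ψ (x i) * r) (hg : r * φ (g k) = ψ (g k) * r) (a : Bk k) :
    r * φ a = ψ a * r := by
  induction a using Bk.induction with
  | hc c => simp only [AlgHom.commutes, Algebra.commutes]
  | hx i => exact hx i
  | hg => exact hg
  | hadd a b ha hb => simp only [map_add, mul_add, add_mul, ha, hb]
  | hmul a b ha hb => simp only [map_mul]; rw [← mul_assoc, ha, mul_assoc, hb, mul_assoc]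

theorem R0_eq : R0 k = (2⁻¹ : ℂ) • ((1 : Bk k) ⊗ₜ[ℂ] (1 : Bk k) + g k ⊗ₜ 1 + 1 ⊗ₜ g k
    - g k ⊗ₜ g k) := by
  simp only [R0, TensorProduct.add_tmul, TensorProduct.sub_tmul, TensorProduct.smul_tmul',
    smul_add, smul_sub, add_assoc, add_sub_assoc]

theorem R0_mul_R0 : R0 k * R0 k = 1 := by
  simp only [R0_eq, smul_mul_smul_comm, add_mul, mul_add, sub_mul, mul_sub,
    Algebra.TensorProduct.tmul_mul_tmul, one_mul, mul_one, g_mul_self,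
    Algebra.TensorProduct.one_def]
  module

theorem leg12_tmul (a b : Bk k) : leg12 (K := ℂ) (a ⊗ₜ[ℂ] b) = (a ⊗ₜ b) ⊗ₜ 1 := rfl

theorem leg13_tmul (a b : Bk k) : leg13 (K := ℂ) (a ⊗ₜ[ℂ] b) = (a ⊗ₜ 1) ⊗ₜ b := rfl

theorem leg23_tmul (a b : Bk k) : leg23 (K := ℂ) (a ⊗ₜ[ℂ] b) = (1 ⊗ₜ a) ⊗ₜ b := rfl

theorem comulLeft_tmul (a b : Bk k) :
    comulLeft (K := ℂ) (a ⊗ₜ[ℂ] b) = Bialgebra.comulAlgHom ℂ (Bk k) a ⊗ₜ b := rfl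

theorem comulRight_tmul (a b : Bk k) :
    comulRight (K := ℂ) (a ⊗ₜ[ℂ] b) = (Algebra.TensorProduct.assoc ℂ ℂ ℂ (Bk k) (Bk k) (Bk k)).symm
      (a ⊗ₜ Bialgebra.comulAlgHom ℂ (Bk k) b) := rfl

theorem R0_isRMatrix : IsRMatrix (R0 k) where
  isUnit := ⟨⟨_, _, R0_mul_R0, R0_mul_R0⟩, rfl⟩
  mul_comul := by
    apply intertwine
    · intro i
      simp only [comulAlgHom_x, comulOp_x, R0_eq, smul_mul_assoc, mul_smul_comm, add_mul, mul_add,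
        sub_mul, mul_sub, Algebra.TensorProduct.tmul_mul_tmul, one_mul, mul_one, g_mul_self,
        g_mul_x, TensorProduct.neg_tmul, TensorProduct.tmul_neg]
      module
    · simp only [comulAlgHom_g, comulOp_g, R0_eq, smul_mul_assoc, mul_smul_comm, add_mul, mul_add,
        sub_mul, mul_sub, Algebra.TensorProduct.tmul_mul_tmul, one_mul, mul_one, g_mul_self]
  comulLeft_eq := by
    simp only [R0_eq, map_smul, map_add, map_sub, leg13_tmul, leg23_tmul, comulLeft_tmul,
      comulAlgHom_g, map_one, smul_mul_smul_comm, add_mul, mul_add, sub_mul, mul_sub,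
      Algebra.TensorProduct.tmul_mul_tmul, one_mul, mul_one, g_mul_self,
      Algebra.TensorProduct.one_def]
    module
  comulRight_eq := by
    simp only [R0_eq, map_smul, map_add, map_sub, leg13_tmul, leg12_tmul, comulRight_tmul,
      comulAlgHom_g, map_one, smul_mul_smul_comm, add_mul, mul_add, sub_mul, mul_sub,
      Algebra.TensorProduct.tmul_mul_tmul, one_mul, mul_one, g_mul_self,
      Algebra.TensorProduct.one_def, Algebra.TensorProduct.assoc_symm_tmul]
    module

/-! ### The linearised equations, and the solutions `x_i ⊗ x_j g`. -/

theorem leg12_R0_mul_self : leg12 (R0 k) * leg12 (R0 k) = 1 := by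
  rw [← map_mul, R0_mul_R0, map_one]

theorem leg13_R0_mul_self : leg13 (R0 k) * leg13 (R0 k) = 1 := by
  rw [← map_mul, R0_mul_R0, map_one]

theorem leg23_R0_mul_self : leg23 (R0 k) * leg23 (R0 k) = 1 := by
  rw [← map_mul, R0_mul_R0, map_one]

/-- The tangent space at `R₀`, translated to the identity by `R₀`. -/
theorem R0_mul_mem_tangentRMat_iff (S : Bk k ⊗[ℂ] Bk k) : R0 k * S ∈ tangentRMat (R0 k) ↔
    (∀ a : Bk k, S * Bialgebra.comulAlgHom ℂ (Bk k) a = Bialgebra.comulAlgHom ℂ (Bk k) a * S) ∧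
    comulLeft S = leg23 (R0 k) * leg13 S * leg23 (R0 k) + leg23 S ∧
    comulRight S = leg12 (R0 k) * leg13 S * leg12 (R0 k) + leg12 S := by
  have hR := R0_isRMatrix (k := k)
  have cancel : ∀ {A : Type} [Ring A] {r : A}, r * r = 1 → ∀ {u v : A}, r * u = r * v ↔ u = v := by
    intro A _ r hr u v
    refine ⟨fun h => ?_, fun h => h ▸ rfl⟩
    simpa [← mul_assoc, hr] using congrArg (r * ·) h
  change (_ ∧ _ ∧ _) ↔ _
  refine and_congr (forall_congr' fun a => ?_) (and_congr ?_ ?_)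
  · rw [← mul_assoc, ← hR.mul_comul, mul_assoc, mul_assoc, cancel R0_mul_R0]
  -- The left side is `R₁₃R₂₃ · (Δ⊗id)S`. Cancel `R₁₃`, then multiply by the involution `R₂₃`, which
  -- leaves `R₂₃S₁₃R₂₃ + S₂₃`.
  · rw [map_mul, map_mul, map_mul, hR.comulLeft_eq, mul_assoc, mul_assoc, ← mul_add,
      cancel leg13_R0_mul_self, ← cancel leg23_R0_mul_self, ← mul_assoc, leg23_R0_mul_self, one_mul,
      mul_add, ← mul_assoc, ← mul_assoc, leg23_R0_mul_self, one_mul]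
  · rw [map_mul, map_mul, map_mul, hR.comulRight_eq, mul_assoc, mul_assoc, ← mul_add,
      cancel leg13_R0_mul_self, ← cancel leg12_R0_mul_self, ← mul_assoc, leg12_R0_mul_self, one_mul,
      mul_add, ← mul_assoc, ← mul_assoc, leg12_R0_mul_self, one_mul]

theorem comulAlgHom_mul_X (i j : Fin k) (a : Bk k) :
    X i j * Bialgebra.comulAlgHom ℂ (Bk k) a = Bialgebra.comulAlgHom ℂ (Bk k) a * X i j := by
  revert a
  apply intertwine
  · intro l
    simp only [comulAlgHom_x, X, add_mul, mul_add, Algebra.TensorProduct.tmul_mul_tmul, one_mul,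
      mul_one, mul_assoc, g_mul_x, g_mul_x_mul, g_mul_self, TensorProduct.tmul_neg, mul_neg]
    rw [← mul_assoc (x j), x_mul_x j l, x_mul_x i l]
    simp only [TensorProduct.neg_tmul, TensorProduct.tmul_neg, neg_mul, mul_assoc, neg_neg]
  · simp only [comulAlgHom_g, X, Algebra.TensorProduct.tmul_mul_tmul, mul_assoc, g_mul_x,
      g_mul_x_mul, g_mul_self, TensorProduct.neg_tmul, TensorProduct.tmul_neg, neg_neg]

/-- Moving an element that anticommutes with `g` past the second leg of `R0` flips the sign of each
`g` there, which amounts to multiplying `R0` by `g ⊗ 1`. So conjugation by `R₂₃` puts a `g` in the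
middle leg. -/
theorem leg23_R0_conj_X (i j : Fin k) : leg23 (R0 k) * leg13 (X i j) * leg23 (R0 k) =
    ((x i ⊗ₜ[ℂ] g k) ⊗ₜ[ℂ] (x j * g k)) := by
  have h : leg13 (X i j) * leg23 (R0 k) =
      leg23 (R0 k) * ((x i ⊗ₜ[ℂ] g k) ⊗ₜ[ℂ] (x j * g k)) := by
    simp only [R0_eq, X, map_smul, map_add, map_sub, leg13_tmul, leg23_tmul,
      smul_mul_assoc, mul_smul_comm, add_mul, mul_add, sub_mul, mul_sub,
      Algebra.TensorProduct.tmul_mul_tmul, one_mul, mul_one, mul_assoc, g_mul_self,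
      g_mul_x_mul, TensorProduct.tmul_neg]
    module
  rw [mul_assoc, h, ← mul_assoc, leg23_R0_mul_self, one_mul]

theorem leg12_R0_conj_X (i j : Fin k) : leg12 (R0 k) * leg13 (X i j) * leg12 (R0 k) =
    ((x i ⊗ₜ[ℂ] g k) ⊗ₜ[ℂ] (x j * g k)) := by
  have h : leg12 (R0 k) * leg13 (X i j) =
      ((x i ⊗ₜ[ℂ] g k) ⊗ₜ[ℂ] (x j * g k)) * leg12 (R0 k) := by
    simp only [R0_eq, X, map_smul, map_add, map_sub, leg13_tmul, leg12_tmul,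
      smul_mul_assoc, mul_smul_comm, add_mul, mul_add, sub_mul, mul_sub,
      Algebra.TensorProduct.tmul_mul_tmul, one_mul, mul_one, g_mul_self,
      g_mul_x, TensorProduct.neg_tmul]
    module
  rw [h, mul_assoc, leg12_R0_mul_self, mul_one]

theorem comulLeft_X (i j : Fin k) : comulLeft (X i j) =
    leg23 (R0 k) * leg13 (X i j) * leg23 (R0 k) + leg23 (X i j) := by
  rw [leg23_R0_conj_X, X, comulLeft_tmul, leg23_tmul, comulAlgHom_x, TensorProduct.add_tmul,
    add_comm]

/-- Because `g² = 1`, `Δ(x_j g) = g ⊗ x_j g + x_j g ⊗ 1`; the factor `g` in `x_j g` is what makes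
the last leg `1`, as `S₁₂` requires. -/
theorem comulRight_X (i j : Fin k) : comulRight (X i j) =
    leg12 (R0 k) * leg13 (X i j) * leg12 (R0 k) + leg12 (X i j) := by
  rw [leg12_R0_conj_X, X, comulRight_tmul, leg12_tmul, map_mul, comulAlgHom_x, comulAlgHom_g]
  simp only [add_mul, Algebra.TensorProduct.tmul_mul_tmul, g_mul_self, one_mul,
    TensorProduct.tmul_add, map_add, Algebra.TensorProduct.assoc_symm_tmul]

theorem R0_mul_X_mem (i j : Fin k) : R0 k * X i j ∈ tangentRMat (R0 k) :=
  (R0_mul_mem_tangentRMat_iff _).2 ⟨comulAlgHom_mul_X i j, comulLeft_X i j, comulRight_X i j⟩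

/-- The exponent `∑ λ_{ij} x_i ⊗ x_j g` of `R_λ`. -/
def expo (lam : Fin k → Fin k → ℂ) : Bk k ⊗[ℂ] Bk k := ∑ i, ∑ j, lam i j • X i j

theorem R0_mul_expo_mem (lam : Fin k → Fin k → ℂ) :
    R0 k * expo lam ∈ tangentRMat (R0 k) := by
  simp only [expo, Finset.mul_sum, mul_smul_comm]
  exact Submodule.sum_mem _ fun i _ => Submodule.sum_mem _ fun j _ =>
    Submodule.smul_mem _ _ (R0_mul_X_mem i j)

/-! ### Nilpotency, exponentials and the family `R_λ`. -/

theorem X_mul_self (i j : Fin k) : X i j * X i j = 0 := by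
  simp [X, x_mul_self]

theorem expo_eq_sum (lam : Fin k → Fin k → ℂ) :
    expo lam = ∑ p : Fin k × Fin k, lam p.1 p.2 • X p.1 p.2 := by
  rw [Fintype.sum_prod_type, expo]

theorem commute_smul_X (lam mu : Fin k → Fin k → ℂ) (p q : Fin k × Fin k) :
    Commute (lam p.1 p.2 • X p.1 p.2) (mu q.1 q.2 • X q.1 q.2) :=
  ((X_commute _ _ _ _).smul_right _).smul_left _

theorem commute_expo (lam mu : Fin k → Fin k → ℂ) : Commute (expo lam) (expo mu) := by
  rw [expo_eq_sum, expo_eq_sum]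
  exact Commute.sum_left _ _ _ fun p _ => Commute.sum_right _ _ _ fun q _ =>
    commute_smul_X lam mu p q

theorem isNilpotent_smul_X (c : ℂ) (i j : Fin k) : IsNilpotent (c • X i j) :=
  ⟨2, by rw [sq, smul_mul_smul_comm, X_mul_self, smul_zero]⟩

theorem isNilpotent_sum_smul_X (lam : Fin k → Fin k → ℂ) (s : Finset (Fin k × Fin k)) :
    IsNilpotent (∑ p ∈ s, lam p.1 p.2 • X p.1 p.2) :=
  Commute.isNilpotent_sum (fun _ _ => isNilpotent_smul_X _ _ _)
    fun _ _ _ _ => commute_smul_X _ _ _ _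

theorem isNilpotent_expo (lam : Fin k → Fin k → ℂ) : IsNilpotent (expo lam) := by
  rw [expo_eq_sum]; exact isNilpotent_sum_smul_X _ _

theorem exp_smul_X (c : ℂ) (i j : Fin k) : IsNilpotent.exp (c • X i j) = 1 + c • X i j := by
  rw [IsNilpotent.exp_eq_sum (k := 2) (by rw [sq, smul_mul_smul_comm, X_mul_self, smul_zero])]
  simp [Finset.sum_range_succ]

theorem noncommProd_eq_exp (lam : Fin k → Fin k → ℂ) (s : Finset (Fin k × Fin k)) (comm) :
    s.noncommProd (fun p => 1 + lam p.1 p.2 • X p.1 p.2) comm =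
      IsNilpotent.exp (∑ p ∈ s, lam p.1 p.2 • X p.1 p.2) := by
  induction s using Finset.cons_induction with
  | empty => simp
  | cons p s hp ih =>
    rw [Finset.noncommProd_cons, Finset.sum_cons, ih, ← exp_smul_X,
      IsNilpotent.exp_add_of_commute (Commute.sum_right _ _ _ fun q _ => commute_smul_X _ _ _ _)
        (isNilpotent_smul_X _ _ _) (isNilpotent_sum_smul_X _ _)]

theorem Rfam_eq (lam : Fin k → Fin k → ℂ) :
    Rfam lam = R0 k * IsNilpotent.exp (expo lam) := by
  rw [expo_eq_sum]
  exact congrArg (R0 k * ·) (noncommProd_eq_exp lam Finset.univ _)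

theorem expo_add (lam mu : Fin k → Fin k → ℂ) : expo (lam + mu) = expo lam + expo mu := by
  simp only [expo, Pi.add_apply, add_smul, Finset.sum_add_distrib]

theorem Rfam_add (lam mu : Fin k → Fin k → ℂ) :
    Rfam (lam + mu) = Rfam lam * R0 k * Rfam mu := by
  rw [Rfam_eq, Rfam_eq, Rfam_eq, expo_add, IsNilpotent.exp_add_of_commute (commute_expo _ _)
    (isNilpotent_expo _) (isNilpotent_expo _)]
  simp only [mul_assoc]
  rw [← mul_assoc (R0 k) (R0 k), R0_mul_R0, one_mul]

theorem commute_exp {A : Type*} [Ring A] [Module ℚ A] {a c : A} (h : Commute a c) :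
    Commute (IsNilpotent.exp a) c := by
  refine Commute.sum_left _ _ _ fun i _ => ?_
  -- Only a `ℚ`-module structure is assumed; rational scalars pass through products because
  -- multiplication on either side is additive, hence `ℚ`-linear.
  have h1 := map_rat_smul (AddMonoidHom.mulLeft c) ((i.factorial : ℚ)⁻¹) (a ^ i)
  have h2 := map_rat_smul (AddMonoidHom.mulRight c) ((i.factorial : ℚ)⁻¹) (a ^ i)
  simp only [AddMonoidHom.coe_mulLeft, AddMonoidHom.mulRight_apply] at h1 h2
  rw [Commute, SemiconjBy, h1, h2, (h.pow_left i).eq]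

theorem exp_conj {A : Type*} [Ring A] [Module ℚ A] {r a : A} (hr : r * r = 1)
    (ha : IsNilpotent a) : IsNilpotent.exp (r * a * r) = r * IsNilpotent.exp a * r := by
  let u : Aˣ := ⟨r, r, hr, hr⟩
  exact (IsNilpotent.map_exp ha (MulSemiringAction.toRingHom (ConjAct Aˣ) A (ConjAct.toConjAct u))).symm

theorem isNilpotent_conj {A : Type*} [Ring A] {r a : A} (hr : r * r = 1)
    (ha : IsNilpotent a) : IsNilpotent (r * a * r) := by
  let u : Aˣ := ⟨r, r, hr, hr⟩
  exact ha.map (MulSemiringAction.toRingHom (ConjAct Aˣ) A (ConjAct.toConjAct u))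

/-- The elements `x_i ⊗ g ⊗ x_j g` and `1 ⊗ x_l ⊗ x_m g` anticommute in the middle and in the last
leg, and the two signs cancel. -/
theorem leg23_R0_conj_commute (i j l m : Fin k) :
    Commute (leg23 (R0 k) * leg13 (X i j) * leg23 (R0 k)) (leg23 (X l m)) := by
  rw [leg23_R0_conj_X, X, leg23_tmul, Commute, SemiconjBy]
  simp only [Algebra.TensorProduct.tmul_mul_tmul, one_mul, mul_one, mul_assoc, g_mul_x,
    g_mul_x_mul, g_mul_self, mul_neg, TensorProduct.tmul_neg, TensorProduct.neg_tmul]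
  rw [x_mul_x j m, TensorProduct.tmul_neg, neg_neg]

theorem leg12_R0_conj_commute (i j l m : Fin k) :
    Commute (leg12 (R0 k) * leg13 (X i j) * leg12 (R0 k)) (leg12 (X l m)) := by
  rw [leg12_R0_conj_X, X, leg12_tmul, Commute, SemiconjBy]
  simp only [Algebra.TensorProduct.tmul_mul_tmul, one_mul, mul_one, mul_assoc, g_mul_self,
    g_mul_x_mul, TensorProduct.tmul_neg, TensorProduct.neg_tmul]
  rw [x_mul_x i l, TensorProduct.neg_tmul, TensorProduct.neg_tmul]
  exact neg_neg _

theorem leg23_R0_conj_expo_commute (lam : Fin k → Fin k → ℂ) :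
    Commute (leg23 (R0 k) * leg13 (expo lam) * leg23 (R0 k)) (leg23 (expo lam)) := by
  simp only [expo_eq_sum, map_sum, map_smul, Finset.mul_sum, Finset.sum_mul, mul_smul_comm,
    smul_mul_assoc]
  exact Commute.sum_left _ _ _ fun p _ => Commute.sum_right _ _ _ fun q _ =>
    ((leg23_R0_conj_commute _ _ _ _).smul_right _).smul_left _

theorem leg12_R0_conj_expo_commute (lam : Fin k → Fin k → ℂ) :
    Commute (leg12 (R0 k) * leg13 (expo lam) * leg12 (R0 k)) (leg12 (expo lam)) := by
  simp only [expo_eq_sum, map_sum, map_smul, Finset.mul_sum, Finset.sum_mul, mul_smul_comm,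
    smul_mul_assoc]
  exact Commute.sum_left _ _ _ fun p _ => Commute.sum_right _ _ _ fun q _ =>
    ((leg12_R0_conj_commute _ _ _ _).smul_right _).smul_left _

/-- The exponential of a sum of commuting nilpotents is the product of exponentials, so with `S =
expo lam` the second equation becomes `R₁₃R₂₃ · (R₂₃ exp(S₁₃) R₂₃) exp(S₂₃) = R₁₃ exp(S₁₃) · R₂₃
exp(S₂₃)`; the third is the same with `R₁₂`. -/
theorem Rfam_isRMatrix (lam : Fin k → Fin k → ℂ) : IsRMatrix (Rfam lam) := by
  have hR := R0_isRMatrix (k := k)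
  have hn := isNilpotent_expo lam
  obtain ⟨h1, h2, h3⟩ := (R0_mul_mem_tangentRMat_iff _).1 (R0_mul_expo_mem lam)
  let _ : Module ℚ ((Bk k ⊗[ℂ] Bk k) ⊗[ℂ] Bk k) := Module.compHom _ (algebraMap ℚ ℂ)
  rw [Rfam_eq]
  refine ⟨hR.isUnit.mul (IsNilpotent.isUnit_exp hn), fun a => ?_, ?_, ?_⟩
  · have hc : Commute (IsNilpotent.exp (expo lam)) (Bialgebra.comulAlgHom ℂ (Bk k) a) :=
      commute_exp (h1 a)
    rw [mul_assoc, hc.eq, ← mul_assoc, hR.mul_comul, mul_assoc]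
  · rw [map_mul, map_mul, map_mul, hR.comulLeft_eq, IsNilpotent.map_exp hn, h2,
      IsNilpotent.exp_add_of_commute (leg23_R0_conj_expo_commute lam)
        (isNilpotent_conj leg23_R0_mul_self (hn.map _)) (hn.map _),
      exp_conj leg23_R0_mul_self (hn.map _), IsNilpotent.map_exp hn, IsNilpotent.map_exp hn]
    simp only [mul_assoc]
    rw [← mul_assoc (leg23 (R0 k)) (leg23 (R0 k)), leg23_R0_mul_self, one_mul]
  · rw [map_mul, map_mul, map_mul, hR.comulRight_eq, IsNilpotent.map_exp hn, h3,
      IsNilpotent.exp_add_of_commute (leg12_R0_conj_expo_commute lam)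
        (isNilpotent_conj leg12_R0_mul_self (hn.map _)) (hn.map _),
      exp_conj leg12_R0_mul_self (hn.map _), IsNilpotent.map_exp hn, IsNilpotent.map_exp hn]
    simp only [mul_assoc]
    rw [← mul_assoc (leg12 (R0 k)) (leg12 (R0 k)), leg12_R0_mul_self, one_mul]

end Bk

/-- A linear map killed by `ker f` factors through `f`. -/
theorem LinearMap.exists_comp_eq_of_ker_le {K V W U : Type*} [Field K] [AddCommGroup V]
    [Module K V] [AddCommGroup W] [Module K W] [AddCommGroup U] [Module K U]
    (f : V →ₗ[K] W) (h : V →ₗ[K] U) (hk : LinearMap.ker f ≤ LinearMap.ker h) :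
    ∃ q : W →ₗ[K] U, ∀ v, q (f v) = h v := by
  obtain ⟨q, hq⟩ := LinearMap.exists_extend
    ((LinearMap.ker f).liftQ h hk ∘ₗ f.quotKerEquivRange.symm.toLinearMap)
  refine ⟨q, fun v => ?_⟩
  have := LinearMap.congr_fun hq ⟨f v, LinearMap.mem_range_self f v⟩
  simpa using this

namespace Bk

variable {k : ℕ}

/-! The Euler derivation. -/

variable (k) in
/-- The grading, as the coaction `x_i ↦ x_i t`, `g ↦ g`. -/
def grading : Bk k →ₐ[ℂ] Polynomial (Bk k) :=
  lift (fun i => Polynomial.C (x i) * Polynomial.X) (Polynomial.C (g k))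
    (fun i j => by
      simp only [Polynomial.C_mul_X_eq_monomial, Polynomial.monomial_mul_monomial, x_mul_x i j,
        map_neg])
    (fun i => by
      rw [← mul_assoc, ← Polynomial.C_mul, g_mul_x, mul_assoc, Polynomial.X_mul_C, ← mul_assoc,
        ← Polynomial.C_mul, Polynomial.C_neg, neg_mul])
    (fun i => by
      simp only [Polynomial.C_mul_X_eq_monomial, Polynomial.monomial_mul_monomial, x_mul_self,
        map_zero])
    (by rw [← Polynomial.C_mul, g_mul_self, Polynomial.C_1])

theorem grading_x (i : Fin k) : grading k (x i) = Polynomial.C (x i) * Polynomial.X := by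
  simp [grading]

theorem grading_g : grading k (g k) = Polynomial.C (g k) := by
  simp [grading]

variable (k) in
/-- Evaluation at `1`. -/
def evalOne : Polynomial (Bk k) →ₐ[ℂ] Bk k :=
  Polynomial.eval₂AlgHom (AlgHom.id ℂ (Bk k)) 1 fun a => Commute.one_right a

theorem evalOne_C (a : Bk k) : evalOne k (Polynomial.C a) = a :=
  Polynomial.eval₂_C _ _

theorem evalOne_X : evalOne k Polynomial.X = 1 :=
  Polynomial.eval₂_X _ _

theorem evalOne_grading (a : Bk k) : evalOne k (grading k a) = a := by
  change ((evalOne k).comp (grading k)) a = AlgHom.id ℂ _ a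
  congr 1
  apply algHom_ext
  · intro i; simp [evalOne_C, evalOne_X, grading_x]
  · simp [evalOne_C, grading_g]

variable (k) in
/-- The Euler derivation `x_i ↦ x_i`, `g ↦ 0`. -/
def euler : Bk k →ₗ[ℂ] Bk k :=
  (evalOne k).toLinearMap ∘ₗ (Polynomial.derivative.restrictScalars ℂ) ∘ₗ (grading k).toLinearMap

theorem euler_apply (a : Bk k) :
    euler k a = evalOne k (Polynomial.derivative (grading k a)) := rfl

theorem euler_x (i : Fin k) : euler k (x i) = x i := by
  simp [euler_apply, grading_x, evalOne_C]

theorem euler_g : euler k (g k) = 0 := by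
  simp [euler_apply, grading_g]

theorem euler_mul (a b : Bk k) : euler k (a * b) = euler k a * b + a * euler k b := by
  simp only [euler_apply, map_mul, Polynomial.derivative_mul, map_add, evalOne_grading]

theorem euler_one : euler k 1 = 0 := by
  simp [euler_apply]

/-- On the component of degree `n` the Euler derivation is multiplication by `n`, that is, `t d/dt`
on the grading polynomial. -/
theorem grading_euler (a : Bk k) :
    grading k (euler k a) = Polynomial.X * Polynomial.derivative (grading k a) := by
  induction a using Bk.induction with
  | hc c =>
    rw [Algebra.algebraMap_eq_smul_one, map_smul, euler_one, map_smul, map_smul, map_one,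
      Polynomial.derivative_smul, Polynomial.derivative_one]
    simp
  | hx i => simp [euler_x, grading_x, Polynomial.X_mul_C]
  | hg => simp [euler_g, grading_g]
  | hadd a b ha hb => simp only [map_add, ha, hb, mul_add]
  | hmul a b ha hb =>
    rw [euler_mul, map_add, map_mul, map_mul, ha, hb, map_mul, Polynomial.derivative_mul, mul_add,
      mul_assoc, ← mul_assoc (grading k a), ← Polynomial.X_mul, mul_assoc]

variable (k) in
/-- The projection to degree `0`. -/
def degZero : Bk k →ₐ[ℂ] Bk k :=
  lift (fun _ => 0) (g k) (by simp) (by simp) (by simp) g_mul_self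

theorem degZero_x (i : Fin k) : degZero k (x i) = 0 := by simp [degZero]

theorem degZero_g : degZero k (g k) = g k := by simp [degZero]

theorem coeff_zero_grading (a : Bk k) : (grading k a).coeff 0 = degZero k a := by
  induction a using Bk.induction with
  | hc c => simp [Polynomial.algebraMap_apply]
  | hx i => simp [grading_x, degZero_x]
  | hg => simp [grading_g, degZero_g]
  | hadd a b ha hb => simp [ha, hb]
  | hmul a b ha hb => simp [ha, hb]

/-- In characteristic zero `t p' = 0` forces `p` to be constant; here `p` is the grading polynomial
of `a`. -/
theorem degZero_of_euler_eq_zero {a : Bk k} (h : euler k a = 0) : degZero k a = a := by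
  have : IsAddTorsionFree (Bk k) := Module.isTorsionFree_nat_iff_isAddTorsionFree.1
    (Module.IsTorsionFree.trans_faithfulSMul ℕ ℂ (Bk k))
  have h1 := grading_euler a
  rw [h, map_zero] at h1
  have h2 : Polynomial.derivative (grading k a) = 0 := by
    ext n
    have := congrArg (fun f => Polynomial.coeff f (n + 1)) h1
    simpa using this.symm
  have h3 := congrArg (evalOne k) (Polynomial.eq_C_of_derivative_eq_zero h2)
  rw [evalOne_grading, coeff_zero_grading] at h3
  rw [evalOne_C] at h3
  exact h3.symm

variable (k) in
/-- The Euler derivation is invertible on the part of positive degree. -/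
theorem exists_euler_inv : ∃ q : Bk k →ₗ[ℂ] Bk k, ∀ a, q (euler k a) = a - degZero k a :=
  LinearMap.exists_comp_eq_of_ker_le (euler k) (LinearMap.id - (degZero k).toLinearMap)
    fun a ha => by simp [degZero_of_euler_eq_zero (LinearMap.mem_ker.1 ha)]

/-! The characters `ε`, `χ` and the skew derivations. -/

variable (k) in
/-- The character `x_i ↦ 0`, `g ↦ -1`. -/
def sgn : Bk k →ₐ[ℂ] ℂ :=
  lift (fun _ => 0) (-1) (by simp) (by simp) (by simp) (by simp)

theorem sgn_x (i : Fin k) : sgn k (x i) = 0 := by simp [sgn]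
theorem sgn_g : sgn k (g k) = -1 := by simp [sgn]
theorem counitHom_x (i : Fin k) : counitHom k (x i) = 0 := by simp [counitHom]
theorem counitHom_g : counitHom k (g k) = 1 := by simp [counitHom]

/-- Degree zero is the group algebra of `ℤ/2ℤ`, which splits along the idempotents `(1 ± g)/2` with
characters `ε` and `sgn`. -/
theorem degZero_eq (a : Bk k) : degZero k a =
    counitHom k a • ((2⁻¹ : ℂ) • (1 + g k)) + sgn k a • ((2⁻¹ : ℂ) • (1 - g k)) := by
  induction a using Bk.induction with
  | hc c =>
    rw [AlgHom.commutes, AlgHom.commutes, AlgHom.commutes, Algebra.algebraMap_eq_smul_one]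
    simp only [Algebra.algebraMap_self, RingHom.id_apply]
    module
  | hx i => simp [degZero_x, counitHom_x, sgn_x]
  | hg => rw [degZero_g, counitHom_g, sgn_g]; module
  | hadd a b ha hb => simp only [map_add, ha, hb]; module
  | hmul a b ha hb =>
    rw [map_mul, ha, hb, map_mul, map_mul]
    simp only [add_mul, mul_add, sub_mul, mul_sub, smul_mul_smul_comm, one_mul, mul_one, g_mul_self]
    module

/-- The two-dimensional representation with `x_i ↦ E₁₂`, the other `x_j ↦ 0`. -/
def rep (i : Fin k) : Bk k →ₐ[ℂ] Matrix (Fin 2) (Fin 2) ℂ :=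
  lift (fun j => if j = i then !![0, 1; 0, 0] else 0) !![-1, 0; 0, 1]
    (fun j l => by split_ifs <;> ext a b <;> fin_cases a <;> fin_cases b <;> simp)
    (fun j => by split_ifs <;> ext a b <;> fin_cases a <;> fin_cases b <;> simp)
    (fun j => by split_ifs <;> ext a b <;> fin_cases a <;> fin_cases b <;> simp)
    (by ext a b; fin_cases a <;> fin_cases b <;> simp)

/-- The coordinate functional of `x_i`; it also takes the value `1` at `x_i g`. -/
def coord (i : Fin k) : Bk k →ₗ[ℂ] ℂ :=
  Matrix.entryLinearMap ℂ ℂ 0 1 ∘ₗ (rep i).toLinearMap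

theorem coord_x (i j : Fin k) : coord i (x j) = if j = i then 1 else 0 := by
  by_cases h : j = i <;> simp [coord, rep, h]

theorem coord_g (i : Fin k) : coord i (g k) = 0 := by
  simp [coord, rep]

/-- The representation is upper triangular with the two characters on its diagonal, so its corner
entry `coord i` obeys the skew Leibniz rule `coord_mul`. -/
theorem rep_entries (i : Fin k) (a : Bk k) :
    rep i a 0 0 = sgn k a ∧ rep i a 1 1 = counitHom k a ∧ rep i a 1 0 = 0 := by
  induction a using Bk.induction with
  | hc c => simp [Algebra.algebraMap_eq_smul_one]
  | hx j => by_cases h : j = i <;> simp [rep, sgn_x, counitHom_x, h]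
  | hg => simp [rep, sgn_g, counitHom_g]
  | hadd a b ha hb => simp [ha, hb]
  | hmul a b ha hb => simp [Matrix.mul_apply, ha, hb]

theorem coord_mul (i : Fin k) (a b : Bk k) :
    coord i (a * b) = coord i a * counitHom k b + sgn k a * coord i b := by
  have ha := rep_entries i a
  have hb := rep_entries i b
  simp [coord, Matrix.mul_apply, ha, hb, add_comm]

theorem coord_one (i : Fin k) : coord i 1 = 0 := by
  simp [coord]

theorem coord_x_mul_g (i j : Fin k) : coord i (x j * g k) = if j = i then 1 else 0 := by
  rw [coord_mul, coord_x, coord_g, counitHom_g]; simp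

end Bk

namespace Bk

variable {k : ℕ}

/-! Contractions of a tensor leg with a functional. -/

/-- Contraction of the left leg. -/
def contrL (f : Bk k →ₗ[ℂ] ℂ) : Bk k ⊗[ℂ] Bk k →ₗ[ℂ] Bk k :=
  (TensorProduct.lid ℂ (Bk k)).toLinearMap ∘ₗ f.rTensor (Bk k)

/-- Contraction of the right leg. -/
def contrR (f : Bk k →ₗ[ℂ] ℂ) : Bk k ⊗[ℂ] Bk k →ₗ[ℂ] Bk k :=
  (TensorProduct.rid ℂ (Bk k)).toLinearMap ∘ₗ f.lTensor (Bk k)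

@[simp] theorem contrL_tmul (f : Bk k →ₗ[ℂ] ℂ) (a b : Bk k) : contrL f (a ⊗ₜ b) = f a • b := by
  simp [contrL]

@[simp] theorem contrR_tmul (f : Bk k →ₗ[ℂ] ℂ) (a b : Bk k) : contrR f (a ⊗ₜ b) = f b • a := by
  simp [contrR]

theorem contrL_mul (f : Bk k →ₐ[ℂ] ℂ) (u v : Bk k ⊗[ℂ] Bk k) :
    contrL f.toLinearMap (u * v) = contrL f.toLinearMap u * contrL f.toLinearMap v := by
  induction u with
  | zero => simp
  | add u u' hu hu' => simp only [add_mul, map_add, hu, hu']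
  | tmul a b =>
    induction v with
    | zero => simp
    | add v v' hv hv' => simp only [mul_add, map_add, hv, hv']
    | tmul c d => simp [smul_smul, mul_comm]

theorem contrR_mul (f : Bk k →ₐ[ℂ] ℂ) (u v : Bk k ⊗[ℂ] Bk k) :
    contrR f.toLinearMap (u * v) = contrR f.toLinearMap u * contrR f.toLinearMap v := by
  induction u with
  | zero => simp
  | add u u' hu hu' => simp only [add_mul, map_add, hu, hu']
  | tmul a b =>
    induction v with
    | zero => simp
    | add v v' hv hv' => simp only [mul_add, map_add, hv, hv']
    | tmul c d => simp [smul_smul, mul_comm]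

theorem contrL_coord_mul (i : Fin k) (u v : Bk k ⊗[ℂ] Bk k) :
    contrL (coord i) (u * v) = contrL (coord i) u * contrL (counitHom k).toLinearMap v +
      contrL (sgn k).toLinearMap u * contrL (coord i) v := by
  induction u with
  | zero => simp
  | add u u' hu hu' => simp only [add_mul, map_add, hu, hu']; abel
  | tmul a b =>
    induction v with
    | zero => simp
    | add v v' hv hv' => simp only [mul_add, map_add, hv, hv']; abel
    | tmul c d => simp [coord_mul, add_smul, smul_smul, mul_comm]

theorem contrR_coord_mul (i : Fin k) (u v : Bk k ⊗[ℂ] Bk k) :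
    contrR (coord i) (u * v) = contrR (coord i) u * contrR (counitHom k).toLinearMap v +
      contrR (sgn k).toLinearMap u * contrR (coord i) v := by
  induction u with
  | zero => simp
  | add u u' hu hu' => simp only [add_mul, map_add, hu, hu']; abel
  | tmul a b =>
    induction v with
    | zero => simp
    | add v v' hv hv' => simp only [mul_add, map_add, hv, hv']; abel
    | tmul c d => simp [coord_mul, add_smul, smul_smul, mul_comm]

/-- The operator `a ↦ ∑ f(a₁) a₂` on `B_k`. -/
def hit (f : Bk k →ₗ[ℂ] ℂ) : Bk k →ₗ[ℂ] Bk k :=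
  contrL f ∘ₗ (Bialgebra.comulAlgHom ℂ (Bk k)).toLinearMap

theorem hit_apply (f : Bk k →ₗ[ℂ] ℂ) (a : Bk k) :
    hit f a = contrL f (Bialgebra.comulAlgHom ℂ (Bk k) a) := rfl

theorem hit_counit (a : Bk k) : hit (counitHom k).toLinearMap a = a := by
  have h := Coalgebra.rTensor_counit_comul (R := ℂ) a
  exact (congrArg (TensorProduct.lid ℂ (Bk k)) h).trans (by simp)

variable (k) in
/-- The automorphism `x_i ↦ x_i`, `g ↦ -g`. -/
def flip : Bk k →ₐ[ℂ] Bk k :=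
  lift x (-g k) x_mul_x (fun i => by rw [neg_mul, mul_neg, g_mul_x]) x_mul_self
    (by rw [neg_mul_neg, g_mul_self])

/-- Contraction with a character is multiplicative, so it suffices to compare generators. -/
theorem hit_sgn (a : Bk k) : hit (sgn k).toLinearMap a = flip k a := by
  induction a using Bk.induction with
  | hc c => simp [hit_apply, Algebra.TensorProduct.one_def,
      Algebra.algebraMap_eq_smul_one, -Bialgebra.comulAlgHom_apply]
  | hx i => rw [hit_apply, comulAlgHom_x]; simp [flip, sgn_x]
  | hg => rw [hit_apply, comulAlgHom_g]; simp [flip, sgn_g]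
  | hadd a b ha hb => simp only [map_add, ha, hb]
  | hmul a b ha hb => rw [hit_apply, map_mul, contrL_mul, ← hit_apply, ← hit_apply, ha, hb, map_mul]

theorem hit_coord_mul (i : Fin k) (a b : Bk k) :
    hit (coord i) (a * b) = hit (coord i) a * b + flip k a * hit (coord i) b := by
  rw [hit_apply, map_mul, contrL_coord_mul, ← hit_apply, ← hit_apply, ← hit_apply, ← hit_apply,
    hit_counit, hit_sgn]

/-- The element `x_i g` commutes with each `x_j` and anticommutes with `g`. Left multiplication by
it thus absorbs the twist in `hit_coord_mul` and makes an ordinary derivation. -/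
theorem x_mul_g_mul_flip (i : Fin k) (a : Bk k) :
    (x i * g k) * flip k a = a * (x i * g k) := by
  refine intertwine (flip k) (AlgHom.id ℂ _) (x i * g k) (fun j => ?_) ?_ a
  · simp only [flip, lift_x, AlgHom.id_apply]
    rw [mul_assoc, g_mul_x, mul_neg, ← mul_assoc, x_mul_x, neg_mul, neg_neg, mul_assoc]
  · simp only [flip, lift_g, AlgHom.id_apply]
    rw [mul_neg, mul_assoc, g_mul_self, g_mul_x_mul, g_mul_self]

/-- The Euler derivation in terms of the skew derivations. -/
theorem sum_hit_coord (a : Bk k) : ∑ i, (x i * g k) * hit (coord i) a = euler k a := by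
  induction a using Bk.induction with
  | hc c =>
    simp [hit_apply, Algebra.algebraMap_eq_smul_one, -Bialgebra.comulAlgHom_apply, coord_one, euler_one,
      Algebra.TensorProduct.one_def]
  | hx j =>
    simp only [hit_apply, comulAlgHom_x, map_add, contrL_tmul, coord_one, coord_x, euler_x,
      zero_smul, zero_add, ite_smul, one_smul, mul_ite, mul_zero, mul_assoc, g_mul_self, mul_one]
    simp
  | hg => simp [hit_apply, comulAlgHom_g, coord_g, euler_g, -Bialgebra.comulAlgHom_apply]
  | hadd a b ha hb => simp only [map_add, mul_add, Finset.sum_add_distrib, ha, hb]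
  | hmul a b ha hb =>
    rw [euler_mul, ← ha, ← hb, Finset.sum_mul, Finset.mul_sum, ← Finset.sum_add_distrib]
    refine Finset.sum_congr rfl fun i _ => ?_
    rw [hit_coord_mul, mul_add, ← mul_assoc _ (flip k a), x_mul_g_mul_flip]
    simp only [mul_assoc]

/-! Contractions of the equations for `S`. -/

theorem contr_comulLeft (f : Bk k →ₗ[ℂ] ℂ) (S : Bk k ⊗[ℂ] Bk k) :
    (contrL f).rTensor (Bk k) (comulLeft S) = (hit f).rTensor (Bk k) S := by
  induction S with
  | zero => simp
  | add u v hu hv => simp only [map_add, hu, hv]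
  | tmul a b => rfl

theorem contr_leg23 (f : Bk k →ₗ[ℂ] ℂ) (S : Bk k ⊗[ℂ] Bk k) :
    (contrL f).rTensor (Bk k) (leg23 S) = f 1 • S := by
  induction S with
  | zero => simp
  | add u v hu hv => simp only [map_add, hu, hv, smul_add]
  | tmul a b => simp [leg23_tmul, TensorProduct.smul_tmul']

theorem contr_leg23_conj (f : Bk k →ₗ[ℂ] ℂ) (u S v : Bk k ⊗[ℂ] Bk k) :
    (contrL f).rTensor (Bk k) (leg23 u * leg13 S * leg23 v) = u * (1 ⊗ₜ contrL f S) * v := by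
  induction S with
  | zero => simp
  | add S S' h h' => simp only [map_add, mul_add, add_mul, h, h', TensorProduct.tmul_add]
  | tmul a b =>
    induction u with
    | zero => simp
    | add S S' h h' => simp only [map_add, add_mul, h, h']
    | tmul c d =>
      induction v with
      | zero => simp
      | add S S' h h' => simp only [map_add, mul_add, h, h']
      | tmul c' d' =>
        simp [leg23_tmul, leg13_tmul, TensorProduct.smul_tmul']

/-- Here the contracted leg is the middle one, the first factor of the coproduct, so the same
operator `hit` appears as for `comulLeft`. -/
theorem contr_comulRight (f : Bk k →ₗ[ℂ] ℂ) (S : Bk k ⊗[ℂ] Bk k) :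
    (contrR f).rTensor (Bk k) (comulRight S) = (hit f).lTensor (Bk k) S := by
  induction S with
  | zero => simp
  | add u v hu hv => simp only [map_add, hu, hv]
  | tmul a b =>
    rw [comulRight_tmul, LinearMap.lTensor_tmul, hit_apply]
    induction Bialgebra.comulAlgHom ℂ (Bk k) b with
    | zero => simp
    | add u v hu hv => simp only [map_add, TensorProduct.tmul_add, hu, hv]
    | tmul c d => simp [TensorProduct.smul_tmul']

theorem contr_leg12 (f : Bk k →ₗ[ℂ] ℂ) (S : Bk k ⊗[ℂ] Bk k) :
    (contrR f).rTensor (Bk k) (leg12 S) = contrR f S ⊗ₜ 1 := rfl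

theorem leg12_conj_tmul (u v : Bk k ⊗[ℂ] Bk k) (a b : Bk k) :
    leg12 u * leg13 (a ⊗ₜ b) * leg12 v = (u * (a ⊗ₜ 1) * v) ⊗ₜ[ℂ] b := by
  change (u ⊗ₜ 1) * ((a ⊗ₜ 1) ⊗ₜ b) * (v ⊗ₜ 1) = _
  simp only [Algebra.TensorProduct.tmul_mul_tmul, one_mul, mul_one]

theorem contr_leg12_conj (f : Bk k →ₐ[ℂ] ℂ) (u S v : Bk k ⊗[ℂ] Bk k) :
    (contrR f.toLinearMap).rTensor (Bk k) (leg12 u * leg13 S * leg12 v) =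
      (contrR f.toLinearMap u ⊗ₜ 1) * S * (contrR f.toLinearMap v ⊗ₜ 1) := by
  induction S with
  | zero => simp
  | add S S' h h' => simp only [map_add, mul_add, add_mul, h, h']
  | tmul a b =>
    rw [leg12_conj_tmul, LinearMap.rTensor_tmul, contrR_mul, contrR_mul]
    simp

/-- By the skew Leibniz rule each term contains `coord i` applied to the second leg of `u`, of `v`
or of `a ⊗ 1`, and all three vanish. -/
theorem contr_coord_leg12_conj (i : Fin k) (u S v : Bk k ⊗[ℂ] Bk k)
    (hu : contrR (coord i) u = 0) (hv : contrR (coord i) v = 0) :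
    (contrR (coord i)).rTensor (Bk k) (leg12 u * leg13 S * leg12 v) = 0 := by
  induction S with
  | zero => simp
  | add S S' h h' => simp only [map_add, mul_add, add_mul, h, h', add_zero]
  | tmul a b =>
    rw [leg12_conj_tmul, LinearMap.rTensor_tmul, contrR_coord_mul, contrR_coord_mul, hu, hv]
    simp [coord_one]

theorem contrL_sgn_R0 : contrL (sgn k).toLinearMap (R0 k) = g k := by
  simp only [R0_eq, map_smul, map_add, map_sub, contrL_tmul, AlgHom.toLinearMap_apply, map_one,
    sgn_g]
  module

theorem contrR_sgn_R0 : contrR (sgn k).toLinearMap (R0 k) = g k := by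
  simp only [R0_eq, map_smul, map_add, map_sub, contrR_tmul, AlgHom.toLinearMap_apply, map_one,
    sgn_g]
  module

theorem contrR_counit_R0 : contrR (counitHom k).toLinearMap (R0 k) = 1 := by
  simp only [R0_eq, map_smul, map_add, map_sub, contrR_tmul, AlgHom.toLinearMap_apply, map_one,
    counitHom_g]
  module

theorem contrR_coord_R0 (i : Fin k) : contrR (coord i) (R0 k) = 0 := by
  simp [R0_eq, coord_one, coord_g]

theorem contrL_hit (f h : Bk k →ₗ[ℂ] ℂ) (S : Bk k ⊗[ℂ] Bk k) :
    contrL h ((hit f).rTensor (Bk k) S) = contrL (h ∘ₗ hit f) S := by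
  induction S with
  | zero => simp
  | add u v hu hv => simp only [map_add, hu, hv]
  | tmul a b => simp

theorem contrR_hit (f h : Bk k →ₗ[ℂ] ℂ) (S : Bk k ⊗[ℂ] Bk k) :
    contrR h ((hit f).lTensor (Bk k) S) = contrR (h ∘ₗ hit f) S := by
  induction S with
  | zero => simp
  | add u v hu hv => simp only [map_add, hu, hv]
  | tmul a b => simp

/-- The character `sgn` has order two under convolution. -/
theorem sgn_comp_hit_sgn :
    (sgn k).toLinearMap ∘ₗ hit (sgn k).toLinearMap = (counitHom k).toLinearMap := by
  have h : (sgn k).comp (flip k) = counitHom k := by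
    apply algHom_ext
    · intro i; simp [flip, sgn_x, counitHom_x]
    · simp [flip, sgn_g, counitHom_g]
  ext a
  simp only [LinearMap.comp_apply, hit_sgn, AlgHom.toLinearMap_apply, ← h, AlgHom.comp_apply]

theorem degZero_rTensor (S : Bk k ⊗[ℂ] Bk k) : (degZero k).toLinearMap.rTensor (Bk k) S =
    ((2⁻¹ : ℂ) • (1 + g k)) ⊗ₜ contrL (counitHom k).toLinearMap S +
      ((2⁻¹ : ℂ) • (1 - g k)) ⊗ₜ contrL (sgn k).toLinearMap S := by
  induction S with
  | zero => simp
  | add u v hu hv => simp only [map_add, hu, hv, TensorProduct.tmul_add]; abel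
  | tmul a b =>
    rw [LinearMap.rTensor_tmul, AlgHom.toLinearMap_apply, degZero_eq, TensorProduct.add_tmul,
      TensorProduct.smul_tmul (counitHom k a), TensorProduct.smul_tmul (sgn k a),
      contrL_tmul, contrL_tmul, AlgHom.toLinearMap_apply, AlgHom.toLinearMap_apply]

theorem degZero_lTensor (S : Bk k ⊗[ℂ] Bk k) : (degZero k).toLinearMap.lTensor (Bk k) S =
    contrR (counitHom k).toLinearMap S ⊗ₜ ((2⁻¹ : ℂ) • (1 + g k)) +
      contrR (sgn k).toLinearMap S ⊗ₜ ((2⁻¹ : ℂ) • (1 - g k)) := by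
  induction S with
  | zero => simp
  | add u v hu hv => simp only [map_add, hu, hv, TensorProduct.add_tmul]; abel
  | tmul a b =>
    rw [LinearMap.lTensor_tmul, AlgHom.toLinearMap_apply, degZero_eq, TensorProduct.tmul_add,
      ← TensorProduct.smul_tmul (counitHom k b), ← TensorProduct.smul_tmul (sgn k b),
      contrR_tmul, contrR_tmul, AlgHom.toLinearMap_apply, AlgHom.toLinearMap_apply]

theorem euler_rTensor (S : Bk k ⊗[ℂ] Bk k) : (euler k).rTensor (Bk k) S =
    ∑ i, ((x i * g k) ⊗ₜ 1) * (hit (coord i)).rTensor (Bk k) S := by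
  induction S with
  | zero => simp
  | add u v hu hv => simp only [map_add, hu, hv, mul_add, Finset.sum_add_distrib]
  | tmul a b =>
    simp only [LinearMap.rTensor_tmul, ← sum_hit_coord, TensorProduct.sum_tmul,
      Algebra.TensorProduct.tmul_mul_tmul, one_mul]

theorem euler_lTensor (S : Bk k ⊗[ℂ] Bk k) : (euler k).lTensor (Bk k) S =
    ∑ i, (1 ⊗ₜ (x i * g k)) * (hit (coord i)).lTensor (Bk k) S := by
  induction S with
  | zero => simp
  | add u v hu hv => simp only [map_add, hu, hv, mul_add, Finset.sum_add_distrib]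
  | tmul a b =>
    simp only [LinearMap.lTensor_tmul, ← sum_hit_coord, TensorProduct.tmul_sum,
      Algebra.TensorProduct.tmul_mul_tmul, one_mul]

theorem euler_x_mul_g (i : Fin k) : euler k (x i * g k) = x i * g k := by
  rw [euler_mul, euler_x, euler_g, mul_zero, add_zero]

/-! ### Vanishing of the contractions with `ε` and `sgn`. -/

/-- Contracting the first leg with `ε` gives `S = R₀(1 ⊗ c)R₀ + S`, where `c` is the contraction of
`S`; hence `c = 0`. -/
theorem contrL_counit_eq_zero {S : Bk k ⊗[ℂ] Bk k}
    (h : comulLeft S = leg23 (R0 k) * leg13 S * leg23 (R0 k) + leg23 S) :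
    contrL (counitHom k).toLinearMap S = 0 := by
  have h1 := congrArg ((contrL (counitHom k).toLinearMap).rTensor (Bk k)) h
  have hid : hit (counitHom k).toLinearMap = LinearMap.id := LinearMap.ext hit_counit
  rw [map_add, contr_comulLeft, contr_leg23_conj, contr_leg23, hid, LinearMap.rTensor_id,
    AlgHom.toLinearMap_apply, map_one, one_smul, LinearMap.id_apply, right_eq_add] at h1
  have h2 := congrArg (fun T => contrL (counitHom k).toLinearMap (R0 k * T * R0 k)) h1
  simp only [← mul_assoc, R0_mul_R0, one_mul] at h2
  rw [mul_assoc, R0_mul_R0, mul_one] at h2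
  simpa using h2

theorem contrR_counit_eq_zero {S : Bk k ⊗[ℂ] Bk k}
    (h : comulRight S = leg12 (R0 k) * leg13 S * leg12 (R0 k) + leg12 S) :
    contrR (counitHom k).toLinearMap S = 0 := by
  have h1 := congrArg ((contrR (counitHom k).toLinearMap).rTensor (Bk k)) h
  have hid : hit (counitHom k).toLinearMap = LinearMap.id := LinearMap.ext hit_counit
  rw [map_add, contr_comulRight, contr_leg12_conj, contr_leg12, hid, LinearMap.lTensor_id,
    contrR_counit_R0, ← Algebra.TensorProduct.one_def, one_mul, mul_one, LinearMap.id_apply,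
    left_eq_add] at h1
  simpa using congrArg (contrR (counitHom k).toLinearMap) h1

theorem eq_zero_of_conj_add {c : Bk k} (hc : c * -g k = -g k * c)
    (h : 0 = g k * c * g k + c) : c = 0 := by
  have hc' : c * g k = g k * c := by simpa using hc
  rw [mul_assoc, hc', g_mul_g_mul, ← two_smul ℂ] at h
  exact (smul_eq_zero.1 h.symm).resolve_left two_ne_zero

/-- Contracting twice with `sgn` gives `ε` on the left, where the contraction is already known to
vanish, and `gcg + c` on the right. Commutation of `S` with `g ⊗ g` makes `c` commute with `g`, so
`2c = 0`. -/
theorem contrL_sgn_eq_zero {S : Bk k ⊗[ℂ] Bk k}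
    (hg : S * (g k ⊗ₜ g k) = (g k ⊗ₜ g k) * S)
    (h : comulLeft S = leg23 (R0 k) * leg13 S * leg23 (R0 k) + leg23 S) :
    contrL (sgn k).toLinearMap S = 0 := by
  have h1 := congrArg ((contrL (sgn k).toLinearMap).rTensor (Bk k)) h
  rw [map_add, contr_comulLeft, contr_leg23_conj, contr_leg23,
    AlgHom.toLinearMap_apply, map_one, one_smul] at h1
  have h2 := congrArg (contrL (sgn k).toLinearMap) h1
  rw [contrL_hit, sgn_comp_hit_sgn, contrL_counit_eq_zero h, map_add, contrL_mul, contrL_mul,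
    contrL_sgn_R0, contrL_tmul, AlgHom.toLinearMap_apply, map_one, one_smul] at h2
  refine eq_zero_of_conj_add ?_ h2
  have h3 := congrArg (contrL (sgn k).toLinearMap) hg
  rw [contrL_mul, contrL_mul] at h3
  simpa [sgn_g] using h3

theorem contrR_sgn_eq_zero {S : Bk k ⊗[ℂ] Bk k}
    (hg : S * (g k ⊗ₜ g k) = (g k ⊗ₜ g k) * S)
    (h : comulRight S = leg12 (R0 k) * leg13 S * leg12 (R0 k) + leg12 S) :
    contrR (sgn k).toLinearMap S = 0 := by
  have h1 := congrArg ((contrR (sgn k).toLinearMap).rTensor (Bk k)) h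
  rw [map_add, contr_comulRight, contr_leg12_conj, contr_leg12, contrR_sgn_R0] at h1
  have h2 := congrArg (contrR (sgn k).toLinearMap) h1
  rw [contrR_hit, sgn_comp_hit_sgn, contrR_counit_eq_zero h, map_add, contrR_mul, contrR_mul,
    contrR_tmul, contrR_tmul, AlgHom.toLinearMap_apply, map_one, one_smul, one_smul] at h2
  refine eq_zero_of_conj_add ?_ h2
  have h3 := congrArg (contrR (sgn k).toLinearMap) hg
  rw [contrR_mul, contrR_mul] at h3
  simpa [sgn_g] using h3

/-! ### Solving the linearised equations. -/

/-- The solutions of the linearised equations are determined by their right coordinates. -/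
theorem eq_sum_contrR_coord {S : Bk k ⊗[ℂ] Bk k}
    (hg : S * (g k ⊗ₜ g k) = (g k ⊗ₜ g k) * S)
    (h : comulRight S = leg12 (R0 k) * leg13 S * leg12 (R0 k) + leg12 S) :
    S = ∑ i, contrR (coord i) S ⊗ₜ (x i * g k) := by
  have h1 : ∀ i, (hit (coord i)).lTensor (Bk k) S = contrR (coord i) S ⊗ₜ 1 := fun i => by
    rw [← contr_comulRight, h, map_add, contr_coord_leg12_conj i _ _ _ (contrR_coord_R0 i)
      (contrR_coord_R0 i), zero_add, contr_leg12]
  have h2 : (euler k).lTensor (Bk k) S = ∑ i, contrR (coord i) S ⊗ₜ (x i * g k) := by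
    simp only [euler_lTensor, h1, Algebra.TensorProduct.tmul_mul_tmul, one_mul, mul_one]
  obtain ⟨q, hq⟩ := exists_euler_inv k
  have hq' : q ∘ₗ euler k = LinearMap.id - (degZero k).toLinearMap := LinearMap.ext hq
  -- In degree one the Euler derivation is the identity, so its inverse `q` fixes these elements.
  have hqx : ∀ i, q (x i * g k) = x i * g k := fun i => by
    conv_lhs => rw [← euler_x_mul_g]
    rw [hq, map_mul, degZero_x, zero_mul, sub_zero]
  have h3 := congrArg (q.lTensor (Bk k)) h2
  rw [← LinearMap.comp_apply, ← LinearMap.lTensor_comp, hq', LinearMap.lTensor_sub,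
    LinearMap.sub_apply, degZero_lTensor, contrR_counit_eq_zero h, contrR_sgn_eq_zero hg h,
    TensorProduct.zero_tmul, TensorProduct.zero_tmul, add_zero, sub_zero, LinearMap.lTensor_id,
    LinearMap.id_apply, map_sum] at h3
  simpa only [LinearMap.lTensor_tmul, hqx] using h3

theorem R0_conj_one_tmul {s : Bk k} (hs : g k * s = -(s * g k)) :
    R0 k * (1 ⊗ₜ s) * R0 k = g k ⊗ₜ s := by
  have h : R0 k * (1 ⊗ₜ s) = (g k ⊗ₜ s) * R0 k := by
    simp only [R0_eq, smul_mul_assoc, mul_smul_comm, add_mul, mul_add, sub_mul, mul_sub,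
      Algebra.TensorProduct.tmul_mul_tmul, one_mul, mul_one, g_mul_self, hs,
      TensorProduct.tmul_neg]
    module
  rw [h, mul_assoc, R0_mul_R0, mul_one]

/-- Contraction of the first leg with `coord i` leaves `R₀(1 ⊗ s)R₀`, which is `g ⊗ s` once `s`
anticommutes with `g`; this is the role of `hs`. The new `g` then cancels the one in the Euler
factor `x_i g`. -/
theorem eq_sum_contrL_coord {S : Bk k ⊗[ℂ] Bk k}
    (hg : S * (g k ⊗ₜ g k) = (g k ⊗ₜ g k) * S)
    (h : comulLeft S = leg23 (R0 k) * leg13 S * leg23 (R0 k) + leg23 S)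
    (hs : ∀ i, g k * contrL (coord i) S = -(contrL (coord i) S * g k)) :
    S = ∑ i, x i ⊗ₜ contrL (coord i) S := by
  have h1 : ∀ i, (hit (coord i)).rTensor (Bk k) S = g k ⊗ₜ contrL (coord i) S := fun i => by
    rw [← contr_comulLeft, h, map_add, contr_leg23_conj, contr_leg23, coord_one, zero_smul,
      add_zero, R0_conj_one_tmul (hs i)]
  have h2 : (euler k).rTensor (Bk k) S = ∑ i, x i ⊗ₜ contrL (coord i) S := by
    simp only [euler_rTensor, h1, Algebra.TensorProduct.tmul_mul_tmul, one_mul, mul_assoc,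
      g_mul_self, mul_one]
  obtain ⟨q, hq⟩ := exists_euler_inv k
  have hq' : q ∘ₗ euler k = LinearMap.id - (degZero k).toLinearMap := LinearMap.ext hq
  have hqx : ∀ i, q (x i) = x i := fun i => by
    conv_lhs => rw [← euler_x]
    rw [hq, degZero_x, sub_zero]
  have h3 := congrArg (q.rTensor (Bk k)) h2
  rw [← LinearMap.comp_apply, ← LinearMap.rTensor_comp, hq', LinearMap.rTensor_sub,
    LinearMap.sub_apply, degZero_rTensor, contrL_counit_eq_zero h, contrL_sgn_eq_zero hg h,
    TensorProduct.tmul_zero, TensorProduct.tmul_zero, add_zero, sub_zero, LinearMap.rTensor_id,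
    LinearMap.id_apply, map_sum] at h3
  simpa only [LinearMap.rTensor_tmul, hqx] using h3

/-- The solutions of the linearised equations are spanned by the `x_i ⊗ x_j g`. -/
theorem eq_expo_of_R0_mul_mem {S : Bk k ⊗[ℂ] Bk k} (hS : R0 k * S ∈ tangentRMat (R0 k)) :
    S = expo fun i j => coord i (contrR (coord j) S) := by
  obtain ⟨hc, hl, hr⟩ := (R0_mul_mem_tangentRMat_iff S).1 hS
  have hg := hc (g k)
  rw [comulAlgHom_g] at hg
  -- The right leg is expanded first: it shows that the left contractions are combinations of the
  -- `x_j g`, hence anticommute with `g`, as the left expansion needs.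
  have h1 : ∀ i, contrL (coord i) S = ∑ j, coord i (contrR (coord j) S) • (x j * g k) :=
    fun i => by
      conv_lhs => rw [eq_sum_contrR_coord hg hr]
      simp only [map_sum, contrL_tmul]
  have hs : ∀ i, g k * contrL (coord i) S = -(contrL (coord i) S * g k) := fun i => by
    simp only [h1, Finset.mul_sum, Finset.sum_mul, mul_smul_comm, smul_mul_assoc, g_mul_x_mul,
      mul_assoc, smul_neg, Finset.sum_neg_distrib]
  conv_lhs => rw [eq_sum_contrL_coord hg hl hs]
  simp only [expo, X, h1, TensorProduct.tmul_sum, TensorProduct.tmul_smul]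

/-- Since `coord` takes the same values at `x_j` and at `x_j g`, one family of functionals is dual
to the elements in both legs; this gives linear independence. -/
theorem coord_contrR_expo (c : Fin k → Fin k → ℂ) (i j : Fin k) :
    coord i (contrR (coord j) (expo c)) = c i j := by
  simp [expo, X, coord_x, coord_x_mul_g]

/-! ### The basis of the tangent space. -/

/-- The tangent vector `R₀ (x_i ⊗ x_j g)`. -/
def tangentVec (p : Fin k × Fin k) : tangentRMat (R0 k) := ⟨_, R0_mul_X_mem p.1 p.2⟩

theorem coe_sum_smul_tangentVec (c : Fin k × Fin k → ℂ) :
    ((∑ p, c p • tangentVec p : tangentRMat (R0 k)) : Bk k ⊗[ℂ] Bk k) =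
      R0 k * expo fun i j => c (i, j) := by
  rw [Submodule.coe_sum, expo_eq_sum, Finset.mul_sum]
  refine Finset.sum_congr rfl fun p _ => ?_
  rw [mul_smul_comm]
  rfl

theorem R0_mul_cancel (T : Bk k ⊗[ℂ] Bk k) : R0 k * (R0 k * T) = T := by
  rw [← mul_assoc, R0_mul_R0, one_mul]

theorem linearIndependent_tangentVec : LinearIndependent ℂ (tangentVec (k := k)) := by
  refine Fintype.linearIndependent_iff.2 fun c hc p => ?_
  have h1 := congrArg (fun T => R0 k * T) (coe_sum_smul_tangentVec c)
  rw [hc] at h1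
  simp only [R0_mul_cancel, ZeroMemClass.coe_zero, mul_zero] at h1
  rw [← coord_contrR_expo (fun i j => c (i, j)) p.1 p.2, ← h1, map_zero, map_zero]

theorem eq_R0_mul_expo_of_mem {T : Bk k ⊗[ℂ] Bk k} (hT : T ∈ tangentRMat (R0 k)) :
    T = R0 k * expo fun i j => coord i (contrR (coord j) (R0 k * T)) := by
  have hT' : R0 k * (R0 k * T) ∈ tangentRMat (R0 k) := by rwa [R0_mul_cancel]
  rw [← eq_expo_of_R0_mul_mem hT', R0_mul_cancel]

theorem span_range_tangentVec : ⊤ ≤ Submodule.span ℂ (Set.range (tangentVec (k := k))) := by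
  intro T _
  obtain ⟨c, hc⟩ : ∃ c : Fin k → Fin k → ℂ, (T : Bk k ⊗[ℂ] Bk k) = R0 k * expo c :=
    ⟨_, eq_R0_mul_expo_of_mem T.2⟩
  have h : T = ∑ p : Fin k × Fin k, c p.1 p.2 • tangentVec p := by
    apply Subtype.ext
    rw [hc, coe_sum_smul_tangentVec fun p => c p.1 p.2]
  rw [h]
  exact Submodule.sum_mem _ fun p _ =>
    Submodule.smul_mem _ _ (Submodule.subset_span (Set.mem_range_self p))

end Bk

end

theorem mainTheorem10 (k : ℕ) (hk : 0 < k) :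
    (∃ b : Module.Basis (Fin k × Fin k) ℂ (tangentRMat (Bk.R0 k)),
      ∀ i j : Fin k, (b (i, j) : Bk k ⊗[ℂ] Bk k) = Bk.R0 k * (Bk.x i ⊗ₜ[ℂ] (Bk.x j * Bk.g k))) ∧
    (∀ lam : Fin k → Fin k → ℂ,
      IsNilpotent (∑ i, ∑ j, lam i j • (Bk.x i ⊗ₜ[ℂ] (Bk.x j * Bk.g k))) ∧
      Bk.Rfam lam =
        Bk.R0 k * IsNilpotent.exp (∑ i, ∑ j, lam i j • (Bk.x i ⊗ₜ[ℂ] (Bk.x j * Bk.g k))) ∧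
      IsRMatrix (Bk.Rfam lam)) ∧
    (∀ lam mu : Fin k → Fin k → ℂ,
      Bk.Rfam (lam + mu) = Bk.Rfam lam * Bk.R0 k * Bk.Rfam mu) := by
  refine ⟨⟨Module.Basis.mk Bk.linearIndependent_tangentVec Bk.span_range_tangentVec, fun i j => ?_⟩,
    fun lam => ⟨Bk.isNilpotent_expo lam, Bk.Rfam_eq lam, Bk.Rfam_isRMatrix lam⟩, Bk.Rfam_add⟩
  rw [Module.Basis.mk_apply]
  rfl
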